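/- Let $d\ge 2$ be an integer. For real $n\ge 1$ let $\mathbb{T}_n$ be the torus obtained from the cube $[-n/2,n/2]^d$ by identifying opposite faces, with its toroidal (quotient Euclidean) distance $\mathrm{d}_{\mathbb{T}_n}$, and let $X^{(n)}$ be an independently marked homogeneous Poisson point process of intensity $1$ in $\mathbb{T}_n$, whose marks are distributed as a random variable $R\in[0,\infty)$, i.e. a Poisson point process on $\mathbb{T}_n\times[0,\infty)$ whose intensity measure is the product of Lebesgue measure and the law of $R$. Assume that the law of $R$ (the same for all $n$) is absolutely continuous and that $\lim_{h\to\infty}h^{d}\,\mathbb{P}(R>h)=\beta$, where $$\beta> d^{d/2}\,2^{2d+1}(d+1)\log 2 .$$ Let $G(X^{(n)})$ be the graph with vertex set $X^{(n)}$ in which there is a directed edge from $(\xi,r)$ to $(\eta,t)$ if $\mathrm{d}_{\mathbb{T}_n}(\xi,\eta)\le r$. Connectedness and graph distances are understood with every directed edge traversable in both directions, and $\operatorname{diam}G(X^{(n)})\in\{0,1,\dots\}\cup\{\infty\}$ is the supremum of the graph distances between two vertices, where vertices in different connected components have distance $\infty$ (and the diameter of the empty graph is $0$). Then: 1. $\mathbb{P}\big(G(X^{(n)})\text{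 is connected}\big)\to 1$ as $n\to\infty$. 2. There are a subcritical Galton–Watson process (one ancestor, the offspring distribution has mean less than $1$ and does not depend on $n$) with total progeny $T$ (the number of all individuals including the ancestor), and for every $n\ge 1$ a coupling of $X^{(n)}$ and $T$, such that $$\mathbb{P}\big(\operatorname{diam}G(X^{(n)})>2+2^{d}\,T\big)=O(n^{-1})\qquad\text{as }n\to\infty .$$ -/

import Mathlib

open Filter Topology MeasureTheory ProbabilityTheory
open scoped NNReal ENNReal

noncomputable section

namespace ScaleFreeGilbert

/-! ### The torus -/

/-- The torus of side length `n`, i.e. `ℝ ^ d` modulo the lattice `n ℤ ^ d`. -/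
abbrev Torus (d : ℕ) (n : ℝ) : Type := Fin d → AddCircle n

/-- The toroidal distance: the quotient of the Euclidean distance. -/
def torusDist {d : ℕ} {n : ℝ} (ξ η : Torus d n) : ℝ :=
  Real.sqrt (∑ i, ‖ξ i - η i‖ ^ 2)

/-- Lebesgue measure on the torus: the image of Lebesgue measure on the cube `[-n/2, n/2] ^ d`
under the identification of its boundaries. -/
def torusVolume (d : ℕ) (n : ℝ) : Measure (Torus d n) :=
  (volume.restrict (Set.Icc (fun _ : Fin d => -n / 2) (fun _ => n / 2))).map
    (fun x i => (x i : AddCircle n))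

/-! ### Poisson point processes -/

/-- The number of points of the finite configuration `S` in the set `A`. -/
def pointCount {E : Type*} (S : Finset E) (A : Set E) : ℕ := ((S : Set E) ∩ A).ncard

/-- `X` is a Poisson point process with intensity measure `Λ` (with finitely many points, which
is the case of a finite measure `Λ`): the number of points in a measurable set `A` is Poisson
distributed with mean `Λ A`, and the numbers of points in pairwise disjoint measurable sets are
independent. -/
structure IsPoissonProcess {Ω E : Type*} [MeasurableSpace Ω] [MeasurableSpace E]
    (X : Ω → Finset E) (Λ : Measure E) (μ : Measure Ω) : Prop where
  hasLaw_count : ∀ A : Set E, MeasurableSet A → Λ A ≠ ∞ →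
    HasLaw (fun ω => pointCount (X ω) A) (poissonMeasure (Λ A).toNNReal) μ
  indep_count : ∀ (k : ℕ) (A : Fin k → Set E), (∀ i, MeasurableSet (A i)) →
    Pairwise (fun i j => Disjoint (A i) (A j)) →
    iIndepFun (fun i ω => pointCount (X ω) (A i)) μ

/-- `X` is an independently marked homogeneous Poisson point process with intensity `1` in the
torus of side length `n`, whose marks have law `ρ`: a Poisson point process of pairs
(point, mark) whose intensity measure is the product of Lebesgue measure and `ρ`. -/
def IsMarkedPoisson {Ω : Type*} [MeasurableSpace Ω] {d : ℕ} {n : ℝ}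
    (X : Ω → Finset (Torus d n × ℝ≥0)) (ρ : Measure ℝ≥0) (μ : Measure Ω) : Prop :=
  IsPoissonProcess X ((torusVolume d n).prod ρ) μ

/-- The law `ρ` of a nonnegative radius `R` is an absolutely continuous probability measure with
`h ^ s * ℙ(R > h) → β` as `h → ∞`. -/
structure IsRadiusLaw (ρ : Measure ℝ≥0) (s β : ℝ) : Prop where
  isProbabilityMeasure : IsProbabilityMeasure ρ
  absolutelyContinuous : ρ.map ((↑) : ℝ≥0 → ℝ) ≪ volume
  tendsto_tail : Tendsto (fun h : ℝ => h ^ s * ρ.real {r : ℝ≥0 | h < r}) atTop (𝓝 β)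

/-! ### The scale-free Gilbert graph -/

/-- The directed graph on the marked points `X`, with an edge from `(ξ, r)` to `(η, t)` if `η`
is in the closed ball of radius `r` centered at `ξ`. -/
def gilbertDigraph {d : ℕ} {n : ℝ} (X : Finset (Torus d n × ℝ≥0)) : Digraph X where
  Adj x y := torusDist x.1.1 y.1.1 ≤ x.1.2

/-- The graph in which chemical distances are measured: every directed edge may be traversed in
both directions. -/
def gilbertGraph {d : ℕ} {n : ℝ} (X : Finset (Torus d n × ℝ≥0)) : SimpleGraph X :=
  (gilbertDigraph X).toSimpleGraphInclusive

/-- The events `E n` occur with high probability as `n → ∞`, i.e. the probabilities of their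
complements tend to `0`. -/
def WithHighProbability {Ω : ℝ → Type*} [∀ n, MeasurableSpace (Ω n)]
    (μ : ∀ n, Measure (Ω n)) (E : ∀ n, Set (Ω n)) : Prop :=
  Tendsto (fun n => μ n (E n)ᶜ) atTop (𝓝 0)

/-! ### Galton–Watson processes -/

/-- The generation sizes of a Galton–Watson process with one ancestor; `c (k, i)` is the number
of children of the `i`-th individual of generation `k`. -/
def generationSize (c : ℕ × ℕ → ℕ) : ℕ → ℕ
  | 0 => 1
  | k + 1 => ∑ i ∈ Finset.range (generationSize c k), c (k, i)

/-- The total progeny, i.e. the number of all individuals including the ancestor. -/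
def totalProgeny (c : ℕ × ℕ → ℕ) : ℕ∞ :=
  ⨆ m : ℕ, ((∑ k ∈ Finset.range m, generationSize c k : ℕ) : ℕ∞)

/-- The law of the total progeny of the Galton–Watson process with offspring distribution `ν`:
all the offspring numbers are independent with law `ν`. -/
def totalProgenyLaw (ν : PMF ℕ) : Measure ℕ∞ :=
  (Measure.infinitePi (fun _ : ℕ × ℕ => ν.toMeasure)).map totalProgeny

/-- An offspring distribution is subcritical if its mean is less than `1`. -/
def IsSubcritical (ν : PMF ℕ) : Prop := ∑' k : ℕ, ν k * (k : ℝ≥0∞) < 1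

/-- `π` is a coupling of `μ` and `μ'`. -/
def IsCoupling {Ω Ω' : Type*} [MeasurableSpace Ω] [MeasurableSpace Ω']
    (π : Measure (Ω × Ω')) (μ : Measure Ω) (μ' : Measure Ω') : Prop :=
  π.map Prod.fst = μ ∧ π.map Prod.snd = μ'

end ScaleFreeGilbert

end

/-! A multiscale argument. At scale `s`, the expected number of points in a cube of side `s` whose
radius lies between `2√d s` and `4√d s` is about `s ^ d` times the mass of that window. The tail
assumption keeps this above `(d + 3) log 2` for all large `s` (`IsRadiusLaw.exists_le_radiusRange`).
Such a point reaches every point of its own dyadic cube and of the neighbouring ones.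

Suppose every cube of level `k` has such a point in itself or in one of its ancestors. Then moving
from cube to neighbouring cube costs one edge each time, and the diameter is at most `2 + 2 ^ k`
(`ediam_gilbertGraph_le`). The radius windows of different levels are disjoint, so the intensities
of the `k + 1` levels add up and a given cube fails with probability at most `2 ^ (-(k + 1) (d +
3))`. A union bound over the `2 ^ (k d)` cubes leaves `4 ^ (-k)` (`measure_not_reached_le`), valid
as long as the cubes of level `k` are not too small, that is up to `k ≈ log₂ n`. The largest
admissible `k` gives connectedness.

For the comparison with a branching process only the first generation matters. If the ancestor has
`2 ^ J - 1` children with `ℙ(J ≥ j) = 4 ^ (-j)`, then `T ≥ 2 ^ J`, while the offspring mean stays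
below `1`. The least `L` with diameter at most `2 + 2 ^ (d + L)` has tails below those of `J` up to
a cutoff of order `log₂ n`, so a monotone coupling (`exists_coupling_le`) makes `L ≤ J` and the
diameter at most `2 + 2 ^ d T`. The cutoff produces the error `O(n⁻¹)`. -/

noncomputable section

namespace ScaleFreeGilbert

/-! ### Dyadic cubes in the torus -/

/-- The closed cube with index `c` in the dyadic subdivision of level `k`. -/
def dyadicCube {d : ℕ} (n : ℝ) (k : ℕ) (c : Fin d → ℕ) : Set (Torus d n) :=
  (fun (x : Fin d → ℝ) i => (x i : AddCircle n)) ''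
    Set.Icc (fun i => -n / 2 + c i * (n / 2 ^ k)) (fun i => -n / 2 + (c i + 1) * (n / 2 ^ k))

/-- The index of the ancestor at level `j` of the dyadic cube with index `c` at level `k`. -/
def ancestor {d : ℕ} (k j : ℕ) (c : Fin d → ℕ) : Fin d → ℕ := fun i => c i / 2 ^ (k - j)

lemma norm_coe_addCircle_le (n x : ℝ) : ‖(x : AddCircle n)‖ ≤ |x| := by
  rw [← Real.norm_eq_abs]
  exact QuotientAddGroup.norm_mk_le_norm

/-- Coordinates in equal or adjacent intervals of length `s` differ by at most `2 * s`. This fixes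
the lower end `2√d s` of the radius windows. -/
lemma torusDist_le_of_mem_dyadicCube {d : ℕ} {n : ℝ} (hn : 0 ≤ n) {k : ℕ} {a b : Fin d → ℕ}
    (hab : ∀ i, a i ≤ b i + 1) (hba : ∀ i, b i ≤ a i + 1) {ξ η : Torus d n}
    (hξ : ξ ∈ dyadicCube n k a) (hη : η ∈ dyadicCube n k b) :
    torusDist ξ η ≤ 2 * Real.sqrt d * (n / 2 ^ k) := by
  obtain ⟨x, ⟨hx1, hx2⟩, rfl⟩ := hξ
  obtain ⟨y, ⟨hy1, hy2⟩, rfl⟩ := hη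
  have hs : 0 ≤ n / 2 ^ k := by positivity
  set s := n / 2 ^ k
  have key : ∀ i, ‖((x i : AddCircle n)) - (y i : AddCircle n)‖ ≤ 2 * s := by
    intro i
    rw [← AddCircle.coe_sub]
    refine (norm_coe_addCircle_le _ _).trans (abs_le.2 ?_)
    have h1 : (a i : ℝ) ≤ b i + 1 := by exact_mod_cast hab i
    have h2 : (b i : ℝ) ≤ a i + 1 := by exact_mod_cast hba i
    have := hx1 i; have := hx2 i; have := hy1 i; have := hy2 i
    simp only at *
    constructor <;> nlinarith
  unfold torusDist
  calc Real.sqrt (∑ i, ‖((x i : AddCircle n)) - (y i : AddCircle n)‖ ^ 2)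
      ≤ Real.sqrt (∑ _i : Fin d, (2 * s) ^ 2) := by
        gcongr with i
        exact key i
    _ = 2 * Real.sqrt d * s := by
        rw [Finset.sum_const, Finset.card_univ, Fintype.card_fin, nsmul_eq_mul,
          Real.sqrt_mul (by positivity), Real.sqrt_sq (by positivity)]
        ring

lemma dyadicCube_subset_ancestor {d : ℕ} {n : ℝ} (hn : 0 ≤ n) {j k : ℕ} (hjk : j ≤ k)
    (c : Fin d → ℕ) : dyadicCube n k c ⊆ dyadicCube n j (ancestor k j c) := by
  refine Set.image_mono (Set.Icc_subset_Icc ?_ ?_)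
  all_goals
    intro i
    have hs : 0 ≤ n / 2 ^ k := by positivity
    have e : n / 2 ^ j = 2 ^ (k - j) * (n / 2 ^ k) := by
      obtain ⟨m, rfl⟩ := Nat.exists_eq_add_of_le hjk
      rw [Nat.add_sub_cancel_left, pow_add]
      field_simp
    simp only [ancestor, e]
    have hlt : c i < 2 ^ (k - j) * (c i / 2 ^ (k - j)) + 2 ^ (k - j) :=
      Nat.lt_mul_div_succ _ (by positivity)
    have hle : 2 ^ (k - j) * (c i / 2 ^ (k - j)) ≤ c i := Nat.mul_div_le _ _
    have hlt' : (c i : ℝ) + 1 ≤ 2 ^ (k - j) * ((c i / 2 ^ (k - j) : ℕ) : ℝ) + 2 ^ (k - j) := by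
      exact_mod_cast hlt
    have hle' : 2 ^ (k - j) * ((c i / 2 ^ (k - j) : ℕ) : ℝ) ≤ c i := by exact_mod_cast hle
    nlinarith

lemma exists_mem_dyadicCube {d : ℕ} {n : ℝ} (hn : 0 < n) (k : ℕ) (ξ : Torus d n) :
    ∃ c : Fin d → ℕ, (∀ i, c i < 2 ^ k) ∧ ξ ∈ dyadicCube n k c := by
  have := Fact.mk hn
  have key : ∀ i, ∃ x : ℝ, ∃ m : ℕ, m < 2 ^ k ∧ -n / 2 + m * (n / 2 ^ k) ≤ x ∧
      x ≤ -n / 2 + (m + 1) * (n / 2 ^ k) ∧ (x : AddCircle n) = ξ i := by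
    intro i
    set y : Set.Ico (-n / 2) (-n / 2 + n) := AddCircle.equivIco n (-n / 2) (ξ i)
    have hy : ((y : ℝ) : AddCircle n) = ξ i := AddCircle.coe_equivIco
    have h1 := y.2.1
    have h2 := y.2.2
    have hs : 0 < n / 2 ^ k := by positivity
    have hsn : n = 2 ^ k * (n / 2 ^ k) := by field_simp
    have h3 : 0 ≤ ((y : ℝ) + n / 2) / (n / 2 ^ k) := div_nonneg (by linarith) hs.le
    refine ⟨y, ⌊((y : ℝ) + n / 2) / (n / 2 ^ k)⌋₊, ?_, ?_, ?_, hy⟩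
    · rw [Nat.floor_lt h3, div_lt_iff₀ hs]
      push_cast
      linarith
    · have := Nat.floor_le h3
      rw [le_div_iff₀ hs] at this
      linarith
    · have := (Nat.lt_floor_add_one (((y : ℝ) + n / 2) / (n / 2 ^ k))).le
      rw [div_le_iff₀ hs] at this
      linarith
  choose x m h1 h2 h3 h4 using key
  exact ⟨m, h1, x, ⟨h2, h3⟩, funext h4⟩

lemma isCompact_dyadicCube {d : ℕ} (n : ℝ) (k : ℕ) (c : Fin d → ℕ) :
    IsCompact (dyadicCube n k c) := by
  refine isCompact_Icc.image (continuous_pi fun i => ?_)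
  exact (AddCircle.continuous_mk' n).comp (continuous_apply i)

lemma measurableSet_dyadicCube {d : ℕ} (n : ℝ) (k : ℕ) (c : Fin d → ℕ) :
    MeasurableSet (dyadicCube n k c) :=
  (isCompact_dyadicCube n k c).measurableSet

/-- A lower bound suffices, since volumes enter only through upper bounds on void probabilities;
identified faces need no care. -/
lemma le_torusVolume_dyadicCube {d : ℕ} {n : ℝ} (hn : 0 ≤ n) {k : ℕ} {c : Fin d → ℕ}
    (hc : ∀ i, c i < 2 ^ k) :
    ENNReal.ofReal ((n / 2 ^ k) ^ d) ≤ torusVolume d n (dyadicCube n k c) := by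
  have hm : Measurable (fun (x : Fin d → ℝ) i => (x i : AddCircle n)) :=
    measurable_pi_lambda _ fun i => AddCircle.measurable_mk'.comp (measurable_pi_apply i)
  have hs : 0 ≤ n / 2 ^ k := by positivity
  have hsn : n = 2 ^ k * (n / 2 ^ k) := by field_simp
  rw [torusVolume, Measure.map_apply hm (measurableSet_dyadicCube n k c)]
  refine le_trans ?_ (measure_mono (Set.subset_preimage_image _ _))
  rw [Measure.restrict_apply measurableSet_Icc, Set.inter_eq_left.2, Real.volume_Icc_pi]
  · simp_rw [show ∀ i, -n / 2 + ((c i : ℝ) + 1) * (n / 2 ^ k) - (-n / 2 + c i * (n / 2 ^ k))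
      = n / 2 ^ k from fun i => by ring]
    rw [Finset.prod_const, Finset.card_univ, Fintype.card_fin, ENNReal.ofReal_pow hs]
  · refine Set.Icc_subset_Icc ?_ ?_
    · intro i
      have : (0 : ℝ) ≤ c i * (n / 2 ^ k) := by positivity
      simp only
      linarith
    · intro i
      have h1 : (c i : ℝ) + 1 ≤ 2 ^ k := by exact_mod_cast hc i
      have := mul_le_mul_of_nonneg_right h1 hs
      simp only
      linarith

/-! ### Stars of large radius connect neighbouring cubes -/

/-- The interval of radii of the order `s`. -/
def radiusRange (d : ℕ) (s : ℝ) : Set ℝ≥0 :=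
  {r : ℝ≥0 | 2 * Real.sqrt d * s < r ∧ (r : ℝ) ≤ 2 * (2 * Real.sqrt d * s)}

/-- The marked points whose position lies in an ancestor of the cube `c` of level `k`, with a
radius of the order of the size of this ancestor. -/
def starRegion {d : ℕ} (n : ℝ) (k : ℕ) (c : Fin d → ℕ) : Set (Torus d n × ℝ≥0) :=
  ⋃ j ∈ Finset.range (k + 1), dyadicCube n j (ancestor k j c) ×ˢ
    radiusRange d (n / 2 ^ j)

/-- King moves on a grid: all coordinates of `b` are shifted one unit towards `a` simultaneously, so
the number of steps is the sup-distance of the indices. -/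
lemma edist_le_of_grid {V : Type*} {G : SimpleGraph V} {d N : ℕ} {z : (Fin d → ℕ) → V}
    (h : ∀ a b : Fin d → ℕ, (∀ i, a i < N) → (∀ i, b i < N) → (∀ i, a i ≤ b i + 1) →
      (∀ i, b i ≤ a i + 1) → G.edist (z a) (z b) ≤ 1) (m : ℕ) :
    ∀ a b : Fin d → ℕ, (∀ i, a i < N) → (∀ i, b i < N) → (∀ i, a i ≤ b i + m) →
      (∀ i, b i ≤ a i + m) → G.edist (z a) (z b) ≤ m := by
  induction m with
  | zero =>
    intro a b ha hb hab hba
    have : a = b := funext fun i => le_antisymm (hab i) (hba i)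
    simp [this]
  | succ m ih =>
    intro a b ha hb hab hba
    set c : Fin d → ℕ := fun i =>
      if b i < a i then b i + 1 else if a i < b i then b i - 1 else b i with hc
    have hcN : ∀ i, c i < N := by
      intro i; have := ha i; have := hb i; simp only [hc]; split_ifs <;> omega
    have h1 : G.edist (z a) (z c) ≤ m := by
      refine ih a c ha hcN (fun i => ?_) (fun i => ?_) <;>
      · have := hab i; have := hba i
        simp only [hc]; split_ifs <;> omega
    have h2 : G.edist (z c) (z b) ≤ 1 := by
      refine h c b hcN hb (fun i => ?_) (fun i => ?_) <;>
      · simp only [hc]; split_ifs <;> omega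
    push_cast
    exact G.edist_triangle.trans (add_le_add h1 h2)

lemma edist_le_one_of_torusDist_le {d : ℕ} {n : ℝ} {X : Finset (Torus d n × ℝ≥0)} {x y : X}
    (h : torusDist x.1.1 y.1.1 ≤ x.1.2) : (gilbertGraph X).edist x y ≤ 1 := by
  rw [SimpleGraph.edist_le_one_iff_adj_or_eq]
  by_cases hxy : x = y
  · exact Or.inr hxy
  · exact Or.inl ((SimpleGraph.fromRel_adj _ _ _).2 ⟨hxy, Or.inl h⟩)

/-- If every cube of level `k` has an ancestor containing a point whose radius is of the order of
the size of this ancestor, then the graph has diameter at most `2 + 2 ^ k`. -/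
lemma ediam_gilbertGraph_le {d : ℕ} {n : ℝ} (hn : 0 < n) {X : Finset (Torus d n × ℝ≥0)} {k : ℕ}
    (h : ∀ c : Fin d → ℕ, (∀ i, c i < 2 ^ k) → ∃ z ∈ X, z ∈ starRegion n k c) :
    Nonempty X ∧ (gilbertGraph X).ediam ≤ 2 + 2 ^ k := by
  have h' : ∀ c : Fin d → ℕ, (∀ i, c i < 2 ^ k) → ∃ z : X, ∃ j ≤ k,
      z.1.1 ∈ dyadicCube n j (ancestor k j c) ∧ 2 * Real.sqrt d * (n / 2 ^ j) < z.1.2 := by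
    intro c hc
    obtain ⟨z, hz, hzs⟩ := h c hc
    simp only [starRegion, radiusRange, Set.mem_iUnion, Finset.mem_range, Set.mem_prod,
      Set.mem_ofPred_eq] at hzs
    obtain ⟨j, hj, h1, h2, -⟩ := hzs
    exact ⟨⟨z, hz⟩, j, by omega, h1, h2⟩
  have hne : Nonempty X := ⟨(h' 0 (fun i => by simp)).choose⟩
  refine ⟨hne, ?_⟩
  choose! z j hjk hz hr using h'
  have hanc : ∀ {a b : Fin d → ℕ} (j : ℕ), (∀ i, a i ≤ b i + 1) →
      ∀ i, ancestor k j a i ≤ ancestor k j b i + 1 := by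
    intro a b j hab i
    unfold ancestor
    calc a i / 2 ^ (k - j) ≤ (b i + 2 ^ (k - j)) / 2 ^ (k - j) :=
          Nat.div_le_div_right ((hab i).trans (by have := Nat.one_le_two_pow (n := k - j); omega))
      _ = _ := Nat.add_div_right _ (by positivity)
  have hancs : ∀ {c : Fin d → ℕ} {i j : ℕ}, i ≤ j → j ≤ k →
      ancestor j i (ancestor k j c) = ancestor k i c := by
    intro c i j hij hjk
    funext l
    simp only [ancestor]
    rw [Nat.div_div_eq_div_mul, ← pow_add]
    congr 2
    omega
  have hstar : ∀ c : Fin d → ℕ, (∀ i, c i < 2 ^ k) → ∀ x : X, x.1.1 ∈ dyadicCube n k c →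
      (gilbertGraph X).edist (z c) x ≤ 1 := by
    intro c hc x hx
    refine edist_le_one_of_torusDist_le (le_trans ?_ (hr c hc).le)
    exact torusDist_le_of_mem_dyadicCube hn.le (fun i => Nat.le_succ _) (fun i => Nat.le_succ _)
      (hz c hc) (dyadicCube_subset_ancestor hn.le (hjk c hc) _ hx)
  -- The star found at the coarser level `j a` does the work: at that level the ancestors of `a` and
  -- `b` still coincide or touch, and the ancestor of `b` contains `z b`.
  have haux : ∀ a b : Fin d → ℕ, (∀ i, a i < 2 ^ k) → (∀ i, b i < 2 ^ k) →
      (∀ i, a i ≤ b i + 1) → (∀ i, b i ≤ a i + 1) → j a ≤ j b →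
      (gilbertGraph X).edist (z a) (z b) ≤ 1 := by
    intro a b ha hb hab hba hj
    refine edist_le_one_of_torusDist_le (le_trans ?_ (hr a ha).le)
    refine torusDist_le_of_mem_dyadicCube hn.le (hanc _ hab) (hanc _ hba) (hz a ha) ?_
    rw [← hancs hj (hjk b hb)]
    exact dyadicCube_subset_ancestor hn.le hj _ (hz b hb)
  have hgrid : ∀ a b : Fin d → ℕ, (∀ i, a i < 2 ^ k) → (∀ i, b i < 2 ^ k) →
      (∀ i, a i ≤ b i + 1) → (∀ i, b i ≤ a i + 1) → (gilbertGraph X).edist (z a) (z b) ≤ 1 := by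
    intro a b ha hb hab hba
    rcases le_total (j a) (j b) with hj | hj
    · exact haux a b ha hb hab hba hj
    · rw [SimpleGraph.edist_comm]
      exact haux b a hb ha hba hab hj
  refine SimpleGraph.ediam_le_iff.2 fun x y => ?_
  obtain ⟨a, ha, hxa⟩ := exists_mem_dyadicCube hn k x.1.1
  obtain ⟨b, hb, hyb⟩ := exists_mem_dyadicCube hn k y.1.1
  have h1 := hstar a ha x hxa
  have h2 := hstar b hb y hyb
  have h3 := edist_le_of_grid hgrid (2 ^ k) a b ha hb (fun i => (ha i).le.trans (Nat.le_add_left _ _))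
    (fun i => (hb i).le.trans (Nat.le_add_left _ _))
  rw [SimpleGraph.edist_comm] at h1
  calc (gilbertGraph X).edist x y ≤ (gilbertGraph X).edist x (z a) +
        ((gilbertGraph X).edist (z a) (z b) + (gilbertGraph X).edist (z b) y) :=
        SimpleGraph.edist_triangle.trans (by gcongr; exact SimpleGraph.edist_triangle)
    _ ≤ 1 + (((2 ^ k : ℕ) : ℕ∞) + 1) := by gcongr
    _ = 2 + 2 ^ k := by push_cast; ring

/-! ### Monotone couplings -/

/-- The interval between two consecutive tail probabilities of the random variable `L`. -/
def tailInterval {Ω : Type*} [MeasurableSpace Ω] (μ : Measure Ω) (L : Ω → ℕ) (l : ℕ) : Set ℝ :=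
  Set.Ioc (μ.real {ω | l + 1 ≤ L ω}) (μ.real {ω | l ≤ L ω})

section

variable {Ω : Type*} [MeasurableSpace Ω] (μ : Measure Ω) [IsProbabilityMeasure μ] {L : Ω → ℕ}

lemma antitone_tail : Antitone fun l : ℕ => μ.real {ω | l ≤ L ω} := fun _ _ hab =>
  measureReal_mono fun _ hω => le_trans hab hω

lemma volume_tailInterval (hL : Measurable L) (l : ℕ) :
    volume (tailInterval μ L l) = μ (L ⁻¹' {l}) := by
  have h : L ⁻¹' {l} = {ω | l ≤ L ω} \ {ω | l + 1 ≤ L ω} := by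
    ext ω; simp only [Set.mem_preimage, Set.mem_singleton_iff, Set.mem_sdiff, Set.mem_ofPred_eq]; omega
  have hm : ∀ l, MeasurableSet {ω | l ≤ L ω} := fun l => measurableSet_le measurable_const hL
  have hsub : {ω | l + 1 ≤ L ω} ⊆ {ω | l ≤ L ω} := fun ω hω => (Nat.le_succ l).trans hω
  rw [tailInterval, Real.volume_Ioc, h, ← measureReal_sdiff hsub (hm _), ofReal_measureReal]

lemma pairwise_disjoint_tailInterval : Pairwise (Function.onFun Disjoint (tailInterval μ L)) := by
  have key : ∀ a b, a < b → Disjoint (tailInterval μ L a) (tailInterval μ L b) := by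
    intro a b hab
    refine Set.disjoint_left.2 fun x hx hx' => ?_
    exact absurd (hx'.2.trans (antitone_tail μ (L := L) hab)) (not_le.2 hx.1)
  intro a b hab
  rcases hab.lt_or_gt with h | h
  · exact key _ _ h
  · exact (key _ _ h).symm

lemma tailInterval_subset (l : ℕ) : tailInterval μ L l ⊆ Set.Ioc 0 1 := fun _ hx =>
  ⟨measureReal_nonneg.trans_lt hx.1, hx.2.trans measureReal_le_one⟩

lemma tendsto_tail_atTop (hL : Measurable L) :
    Tendsto (fun l : ℕ => μ.real {ω | l ≤ L ω}) atTop (𝓝 0) := by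
  have hm : ∀ l, MeasurableSet {ω | l ≤ L ω} := fun l => measurableSet_le measurable_const hL
  have h := tendsto_measure_iInter_atTop (μ := μ) (s := fun l : ℕ => {ω | l ≤ L ω})
    (fun l => (hm l).nullMeasurableSet) (fun a b hab ω hω => le_trans hab hω)
    ⟨0, measure_ne_top _ _⟩
  have he : ⋂ l : ℕ, {ω | l ≤ L ω} = ∅ := by
    ext ω
    simp only [Set.mem_iInter, Set.mem_ofPred_eq, Set.mem_empty_iff_false, iff_false, not_forall]
    exact ⟨L ω + 1, by omega⟩
  rw [he, measure_empty] at h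
  simpa [Measure.real, Function.comp_def] using (ENNReal.tendsto_toReal ENNReal.zero_ne_top).comp h

lemma iUnion_tailInterval (hL : Measurable L) : ⋃ l, tailInterval μ L l = Set.Ioc 0 1 := by
  refine Set.Subset.antisymm (Set.iUnion_subset (tailInterval_subset μ)) fun x hx => ?_
  have hex : ∃ l : ℕ, μ.real {ω | l ≤ L ω} < x :=
    ((tendsto_tail_atTop μ hL).eventually (gt_mem_nhds hx.1)).exists
  classical
  set l := Nat.find hex with hl
  have h0 : l ≠ 0 := by
    intro h
    have := Nat.find_spec hex
    rw [← hl, h] at this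
    simp at this
    linarith [hx.2]
  obtain ⟨m, hm⟩ := Nat.exists_eq_succ_of_ne_zero h0
  refine Set.mem_iUnion.2 ⟨m, ?_, ?_⟩
  · have := Nat.find_spec hex
    rwa [← hl, hm] at this
  · have := Nat.find_min hex (m := m) (by omega)
    exact not_lt.1 this

end

/-- The density of the monotone coupling with respect to the independent one. -/
def couplingDensity {Ω Ω' : Type*} [MeasurableSpace Ω] [MeasurableSpace Ω'] (μ : Measure Ω)
    (μ' : Measure Ω') (L : Ω → ℕ) (J : Ω' → ℕ) (l j : ℕ) : ℝ≥0∞ :=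
  volume (tailInterval μ L l ∩ tailInterval μ' J j) / (μ (L ⁻¹' {l}) * μ' (J ⁻¹' {j}))

lemma couplingDensity_comm {Ω Ω' : Type*} [MeasurableSpace Ω] [MeasurableSpace Ω'] (μ : Measure Ω)
    (μ' : Measure Ω') {L : Ω → ℕ} {J : Ω' → ℕ} (l j : ℕ) :
    couplingDensity μ μ' L J l j = couplingDensity μ' μ J L j l := by
  simp only [couplingDensity, Set.inter_comm, mul_comm]

/-- The values of probability zero are countably many, so the division in the coupling density is
harmless almost everywhere. -/
lemma ae_fiber_ne_zero {Ω : Type*} [MeasurableSpace Ω] (μ : Measure Ω) {L : Ω → ℕ} :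
    ∀ᵐ ω ∂μ, μ (L ⁻¹' {L ω}) ≠ 0 := by
  have h : ∀ l : ℕ, ∀ᵐ ω ∂μ, L ω = l → μ (L ⁻¹' {l}) ≠ 0 := by
    intro l
    by_cases hl : μ (L ⁻¹' {l}) = 0
    · filter_upwards [measure_eq_zero_iff_ae_notMem.1 hl] with ω hω hωl
      exact absurd hωl hω
    · exact ae_of_all _ fun _ _ => hl
  filter_upwards [ae_all_iff.2 h] with ω hω using hω _ rfl

lemma isCoupling_withDensity {Ω Ω' : Type*} [MeasurableSpace Ω] [MeasurableSpace Ω']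
    (μ : Measure Ω) (μ' : Measure Ω') [SFinite μ] [SFinite μ'] {F : Ω × Ω' → ℝ≥0∞} (hF : Measurable F)
    (h1 : ∀ᵐ ω ∂μ, ∫⁻ ω', F (ω, ω') ∂μ' = 1) (h2 : ∀ᵐ ω' ∂μ', ∫⁻ ω, F (ω, ω') ∂μ = 1) :
    IsCoupling ((μ.prod μ').withDensity F) μ μ' := by
  constructor
  · ext A hA
    rw [Measure.map_apply measurable_fst hA, withDensity_apply _ (measurable_fst hA),
      ← Set.prod_univ, ← Measure.prod_restrict, Measure.restrict_univ,
      lintegral_prod _ hF.aemeasurable, lintegral_congr_ae (ae_restrict_of_ae h1)]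
    simp
  · ext A hA
    rw [Measure.map_apply measurable_snd hA, withDensity_apply _ (measurable_snd hA),
      ← Set.univ_prod, ← Measure.prod_restrict, Measure.restrict_univ,
      lintegral_prod_symm _ hF.aemeasurable, lintegral_congr_ae (ae_restrict_of_ae h2)]
    simp

section

variable {Ω Ω' : Type*} [MeasurableSpace Ω] [MeasurableSpace Ω'] (μ : Measure Ω)
  (μ' : Measure Ω') [IsProbabilityMeasure μ] [IsProbabilityMeasure μ'] {L : Ω → ℕ} {J : Ω' → ℕ}

lemma lintegral_couplingDensity (hL : Measurable L) (hJ : Measurable J) {l : ℕ}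
    (hl : μ (L ⁻¹' {l}) ≠ 0) : ∫⁻ ω', couplingDensity μ μ' L J l (J ω') ∂μ' = 1 := by
  have hm : ∀ j, MeasurableSet (tailInterval μ' J j) := fun j => measurableSet_Ioc
  have h1 : ∫⁻ ω', couplingDensity μ μ' L J l (J ω') ∂μ' =
      ∫⁻ j, couplingDensity μ μ' L J l j ∂(μ'.map J) :=
    (lintegral_map (measurable_of_countable _) hJ).symm
  have h2 : ∀ j, couplingDensity μ μ' L J l j * (μ'.map J) {j} =
      volume (tailInterval μ L l ∩ tailInterval μ' J j) * (μ (L ⁻¹' {l}))⁻¹ := by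
    intro j
    rw [Measure.map_apply hJ (measurableSet_singleton j), couplingDensity]
    by_cases hj : μ' (J ⁻¹' {j}) = 0
    · have : volume (tailInterval μ L l ∩ tailInterval μ' J j) = 0 :=
        measure_mono_null Set.inter_subset_right ((volume_tailInterval μ' hJ j).trans hj)
      rw [this, hj]; simp
    · rw [div_eq_mul_inv, ENNReal.mul_inv (Or.inl hl) (Or.inl (measure_ne_top _ _)), mul_assoc,
        mul_assoc, ENNReal.inv_mul_cancel hj (measure_ne_top _ _), mul_one]
  rw [h1, lintegral_countable']
  simp_rw [h2]
  rw [ENNReal.tsum_mul_right, ← measure_iUnion, ← Set.inter_iUnion, iUnion_tailInterval μ' hJ,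
    Set.inter_eq_left.2 (tailInterval_subset μ l), volume_tailInterval μ hL,
    ENNReal.mul_inv_cancel hl (measure_ne_top _ _)]
  · intro a b hab
    exact (pairwise_disjoint_tailInterval μ' hab).mono Set.inter_subset_right Set.inter_subset_right
  · exact fun j => measurableSet_Ioc.inter (hm j)

/-- Two integer valued random variables can be coupled in a monotone way if their tails are
ordered. -/
theorem exists_coupling_le (hL : Measurable L) (hJ : Measurable J)
    (h : ∀ j, μ {ω | j ≤ L ω} ≤ μ' {ω | j ≤ J ω}) :
    ∃ π : Measure (Ω × Ω'), IsCoupling π μ μ' ∧ ∀ᵐ p ∂π, L p.1 ≤ J p.2 := by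
  -- Quantile coupling: one uniform variable on `(0, 1]` selects both values through the intervals
  -- containing it. Using a density that depends only on `(L, J)` lifts this to the product of
  -- arbitrary probability spaces without disintegration.
  obtain ⟨f, hf⟩ : ∃ f : ℕ → ℕ → ℝ≥0∞, f = couplingDensity μ μ' L J := ⟨_, rfl⟩
  have h1 : ∀ᵐ ω ∂μ, ∫⁻ ω', f (L ω) (J ω') ∂μ' = 1 := (ae_fiber_ne_zero μ).mono fun ω hω => by
    rw [hf]
    exact lintegral_couplingDensity μ μ' hL hJ hω
  have h2 : ∀ᵐ ω' ∂μ', ∫⁻ ω, f (L ω) (J ω') ∂μ = 1 := (ae_fiber_ne_zero μ').mono fun ω' hω' => by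
    simp_rw [hf, couplingDensity_comm μ μ']
    exact lintegral_couplingDensity μ' μ hJ hL hω'
  have hg : Measurable fun q : ℕ × ℕ => f q.1 q.2 := measurable_of_countable _
  have hF : Measurable fun p : Ω × Ω' => f (L p.1) (J p.2) :=
    hg.comp ((hL.comp measurable_fst).prodMk (hJ.comp measurable_snd))
  refine ⟨_, isCoupling_withDensity μ μ' hF h1 h2, ?_⟩
  · rw [ae_withDensity_iff hF]
    refine ae_of_all _ fun p hp => ?_
    by_contra hlt
    push Not at hlt
    refine hp ?_
    -- When `J < L`, the ordering of the tails places the whole interval of `L` below that of `J`,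
    -- so the density vanishes.
    have hempty : tailInterval μ L (L p.1) ∩ tailInterval μ' J (J p.2) = ∅ := by
      refine Set.eq_empty_of_forall_notMem fun x hx => ?_
      have h1 : μ.real {ω | L p.1 ≤ L ω} ≤ μ.real {ω | J p.2 + 1 ≤ L ω} :=
        antitone_tail μ (L := L) hlt
      have h2 : μ.real {ω | J p.2 + 1 ≤ L ω} ≤ μ'.real {ω | J p.2 + 1 ≤ J ω} :=
        ENNReal.toReal_mono (measure_ne_top _ _) (h _)
      exact absurd (hx.1.2.trans (h1.trans h2)) (not_le.2 hx.2.1)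
    simp [hf, couplingDensity, hempty]

end

/-! ### A subcritical offspring distribution with a heavy tail -/

/-- The number of summands is random but takes countably many values, so each value can be treated
separately. -/
lemma measurable_generationSize (k : ℕ) :
    Measurable fun c : ℕ × ℕ → ℕ => generationSize c k := by
  induction k with
  | zero => exact measurable_const
  | succ k ih =>
    have h : Measurable fun q : ℕ × (ℕ × ℕ → ℕ) => ∑ i ∈ Finset.range q.1, q.2 (k, i) :=
      measurable_from_prod_countable_right fun N =>
        Finset.measurable_sum (Finset.range N) fun i _ =>
          measurable_pi_apply (X := fun _ : ℕ × ℕ => ℕ) (k, i)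
    exact h.comp (ih.prodMk measurable_id)

lemma measurable_totalProgeny : Measurable totalProgeny := by
  refine measurable_to_countable' fun t => ?_
  have hm : ∀ a : ℕ∞, MeasurableSet {c | totalProgeny c ≤ a} := by
    intro a
    simp only [totalProgeny, iSup_le_iff, Set.ofPred_forall]
    refine MeasurableSet.iInter fun m => ?_
    exact (Finset.measurable_sum (Finset.range m) fun k _ => measurable_generationSize k)
      (MeasurableSet.of_discrete (s := {N : ℕ | (N : ℕ∞) ≤ a}))
  have : totalProgeny ⁻¹' {t} = {c | totalProgeny c ≤ t} \ ⋃ a ∈ Set.Iio t, {c | totalProgeny c ≤ a} := by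
    ext c
    simp only [Set.mem_preimage, Set.mem_singleton_iff, Set.mem_sdiff, Set.mem_ofPred_eq,
      Set.mem_iUnion, Set.mem_Iio, not_exists, not_le]
    constructor
    · rintro rfl; exact ⟨le_rfl, fun a ha => ha⟩
    · rintro ⟨h1, h2⟩
      by_contra hne
      exact absurd (h2 _ (lt_of_le_of_ne h1 hne)) (lt_irrefl _)
  rw [this]
  exact (hm t).diff (MeasurableSet.biUnion (Set.to_countable _) fun a _ => hm a)

lemma one_add_le_totalProgeny (c : ℕ × ℕ → ℕ) : ((1 + c (0, 0) : ℕ) : ℕ∞) ≤ totalProgeny c := by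
  refine le_trans ?_ (le_iSup _ 2)
  simp [Finset.sum_range_succ, generationSize]

/-- The geometric distribution with `ℙ(J ≥ j) = 4⁻ʲ`. -/
def geometricQuarter : PMF ℕ :=
  ⟨fun j => 3 / 4 * (1 / 4) ^ j, by
    rw [ENNReal.summable.hasSum_iff, ENNReal.tsum_mul_left, ENNReal.tsum_geometric]
    rw [← ENNReal.toReal_eq_one_iff]
    have : (1 - 1 / 4 : ℝ≥0∞) = 3 / 4 := by
      rw [← ENNReal.toReal_eq_toReal_iff' (by finiteness) (by finiteness),
        ENNReal.toReal_sub_of_le (by simp) (by simp)]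
      norm_num
    rw [this]
    norm_num⟩

/-- The law of `2 ^ J - 1` for a geometric random variable `J`. -/
def heavyOffspring : PMF ℕ := geometricQuarter.map fun j => 2 ^ j - 1

lemma toMeasure_geometricQuarter_Ici (j : ℕ) :
    geometricQuarter.toMeasure (Set.Ici j) = (1 / 4) ^ j := by
  induction j with
  | zero => simp
  | succ j ih =>
    have h1 : Set.Ici j = {j} ∪ Set.Ici (j + 1) := by
      ext i; simp only [Set.mem_Ici, Set.mem_union, Set.mem_singleton_iff]; omega
    have h2 : Disjoint ({j} : Set ℕ) (Set.Ici (j + 1)) := by simp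
    rw [h1, measure_union h2 measurableSet_Ici,
      PMF.toMeasure_apply_singleton _ _ (measurableSet_singleton _)] at ih
    have h3 : geometricQuarter j ≠ ∞ := PMF.apply_ne_top _ _
    refine (ENNReal.add_right_inj h3).1 (ih.trans ?_)
    change _ = 3 / 4 * (1 / 4 : ℝ≥0∞) ^ j + _
    rw [← ENNReal.toReal_eq_toReal_iff' (by finiteness) (by finiteness),
      ENNReal.toReal_add (by finiteness) (by finiteness)]
    simp only [ENNReal.toReal_mul, ENNReal.toReal_pow, ENNReal.toReal_div]
    norm_num
    ring

lemma isSubcritical_heavyOffspring : IsSubcritical heavyOffspring := by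
  have h : ∑' k : ℕ, heavyOffspring k * (k : ℝ≥0∞) =
      ∑' j : ℕ, geometricQuarter j * ((2 ^ j - 1 : ℕ) : ℝ≥0∞) := by
    have h1 := lintegral_countable' (μ := heavyOffspring.toMeasure) (fun k : ℕ => (k : ℝ≥0∞))
    have h2 := lintegral_countable' (μ := geometricQuarter.toMeasure)
      (fun j : ℕ => ((2 ^ j - 1 : ℕ) : ℝ≥0∞))
    rw [heavyOffspring, ← PMF.toMeasure_map _ _ (measurable_of_countable _),
      lintegral_map (measurable_of_countable _) (measurable_of_countable _), h2] at h1
    rw [PMF.toMeasure_map _ _ (measurable_of_countable _)] at h1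
    simp_rw [PMF.toMeasure_apply_singleton _ _ (measurableSet_singleton _)] at h1
    simp_rw [mul_comm (heavyOffspring _), mul_comm (geometricQuarter _)]
    exact h1.symm
  -- The term `j = 0` vanishes and is split off: bounding `2 ^ j - 1` by `2 ^ j` there too would
  -- give `3 / 2` instead of `3 / 4`.
  rw [IsSubcritical, h, tsum_eq_zero_add' ENNReal.summable]
  have hb : ∀ j : ℕ, geometricQuarter (j + 1) * ((2 ^ (j + 1) - 1 : ℕ) : ℝ≥0∞) ≤
      3 / 8 * (1 / 2) ^ j := by
    intro j
    calc geometricQuarter (j + 1) * ((2 ^ (j + 1) - 1 : ℕ) : ℝ≥0∞)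
        ≤ (3 / 4 * (1 / 4) ^ (j + 1)) * ((2 ^ (j + 1) : ℕ) : ℝ≥0∞) := by
          refine mul_le_mul' le_rfl (Nat.cast_le.2 (Nat.sub_le _ _))
      _ = 3 / 8 * (1 / 2) ^ j := by
          rw [← ENNReal.toReal_eq_toReal_iff' (by finiteness) (by finiteness)]
          simp only [ENNReal.toReal_mul, ENNReal.toReal_pow, ENNReal.toReal_div,
            ENNReal.toReal_natCast]
          norm_num
          rw [pow_succ, pow_succ, show (1 / 4 : ℝ) = 1 / 2 * (1 / 2) by norm_num, mul_pow]
          have : ((1 : ℝ) / 2) ^ j * 2 ^ j = 1 := by rw [← mul_pow]; norm_num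
          linear_combination 3 / 8 * (1 / 2 : ℝ) ^ j * this
  calc geometricQuarter 0 * ((2 ^ 0 - 1 : ℕ) : ℝ≥0∞) +
        ∑' j : ℕ, geometricQuarter (j + 1) * ((2 ^ (j + 1) - 1 : ℕ) : ℝ≥0∞)
      ≤ 0 + ∑' j : ℕ, 3 / 8 * (1 / 2) ^ j := by
        refine add_le_add (by simp) (ENNReal.tsum_le_tsum hb)
    _ = 3 / 4 := by
        rw [ENNReal.tsum_mul_left, ENNReal.tsum_geometric, zero_add, one_div,
          ENNReal.one_sub_inv_two, inv_inv,
          ← ENNReal.toReal_eq_toReal_iff' (by finiteness) (by finiteness)]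
        norm_num
    _ < 1 := by
        rw [← ENNReal.toReal_lt_toReal (by finiteness) (by finiteness)]
        norm_num

/-- One plus the number of children of the ancestor is exactly `2 ^ J`, so the logarithm recovers
the geometric variable. -/
lemma tail_ancestor_heavyOffspring (j : ℕ) :
    Measure.infinitePi (fun _ : ℕ × ℕ => heavyOffspring.toMeasure)
      {c | j ≤ Nat.log 2 (1 + c (0, 0))} = (1 / 4) ^ j := by
  have h := Measure.infinitePi_map_eval (fun _ : ℕ × ℕ => heavyOffspring.toMeasure) (0, 0)
  have h1 : {c : ℕ × ℕ → ℕ | j ≤ Nat.log 2 (1 + c (0, 0))} =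
      (fun c => c (0, 0)) ⁻¹' {m : ℕ | j ≤ Nat.log 2 (1 + m)} := rfl
  rw [h1, ← Measure.map_apply (measurable_pi_apply _) MeasurableSet.of_discrete, h, heavyOffspring,
    ← PMF.toMeasure_map _ _ (measurable_of_countable _),
    Measure.map_apply (measurable_of_countable _) MeasurableSet.of_discrete,
    ← toMeasure_geometricQuarter_Ici]
  congr 1
  ext i
  have : 1 + (2 ^ i - 1) = 2 ^ i := by have := Nat.one_le_two_pow (n := i); omega
  simp [this, Nat.log_pow]

/-! ### Probability that some cube of level `k` is not reached by the star of an ancestor -/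

lemma IsPoissonProcess.measure_void_le {Ω E : Type*} [MeasurableSpace Ω] [MeasurableSpace E]
    {X : Ω → Finset E} {Λ : Measure E} {μ : Measure Ω} (hX : IsPoissonProcess X Λ μ) {A : Set E}
    (hA : MeasurableSet A) (hΛ : Λ A ≠ ∞) {t : ℝ} (ht : ENNReal.ofReal t ≤ Λ A) :
    μ {ω | ∀ z ∈ X ω, z ∉ A} ≤ ENNReal.ofReal (Real.exp (-t)) := by
  have h := hX.hasLaw_count A hA hΛ
  have hset : {ω | ∀ z ∈ X ω, z ∉ A} = (fun ω => pointCount (X ω) A) ⁻¹' {0} := by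
    ext ω
    simp only [Set.mem_ofPred_eq, Set.mem_preimage, Set.mem_singleton_iff, pointCount]
    rw [Set.ncard_eq_zero ((X ω).finite_toSet.subset Set.inter_subset_left),
      Set.eq_empty_iff_forall_notMem]
    simp only [Set.mem_inter_iff, Finset.mem_coe, not_and]
  rw [hset, ← Measure.map_apply_of_aemeasurable h.aemeasurable (measurableSet_singleton 0),
    h.map_eq, poissonMeasure_singleton]
  refine ENNReal.ofReal_le_ofReal ?_
  have : t ≤ (Λ A).toReal := (ENNReal.ofReal_le_iff_le_toReal hΛ).1 ht
  simpa [ENNReal.coe_toNNReal_eq_toReal] using this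

instance isFiniteMeasure_torusVolume (d : ℕ) (n : ℝ) : IsFiniteMeasure (torusVolume d n) := by
  have : IsFiniteMeasure (volume.restrict
      (Set.Icc (fun _ : Fin d => -n / 2) (fun _ => n / 2))) :=
    ⟨by rw [Measure.restrict_apply_univ]; exact isCompact_Icc.measure_lt_top⟩
  exact Measure.isFiniteMeasure_map _ _

lemma measurableSet_radiusRange (d : ℕ) (s : ℝ) : MeasurableSet (radiusRange d s) :=
  (measurableSet_lt measurable_const measurable_subtype_coe).inter
    (measurableSet_le measurable_subtype_coe measurable_const)

lemma measurableSet_starRegion {d : ℕ} (n : ℝ) (k : ℕ) (c : Fin d → ℕ) :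
    MeasurableSet (starRegion n k c) :=
  Finset.measurableSet_biUnion _ fun j _ =>
    (measurableSet_dyadicCube n j _).prod (measurableSet_radiusRange d _)

/-- The windows span a factor of two and the scales shrink by at least that factor. Disjointness
lets nested cubes contribute additively to the intensity. -/
lemma disjoint_radiusRange {d : ℕ} {n : ℝ} (hn : 0 ≤ n) {i j : ℕ} (hij : i < j) :
    Disjoint (radiusRange d (n / 2 ^ i)) (radiusRange d (n / 2 ^ j)) := by
  refine Set.disjoint_left.2 fun r hr hr' => ?_
  have h1 : 2 * (n / 2 ^ j) ≤ n / 2 ^ i := by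
    obtain ⟨m, rfl⟩ := Nat.exists_eq_add_of_lt hij
    rw [show i + m + 1 = i + (m + 1) by ring, pow_add, pow_succ, ← div_div, ← div_div]
    have h2 : n / 2 ^ i / 2 ^ m ≤ n / 2 ^ i := div_le_self (by positivity) (one_le_pow₀ (by norm_num))
    linarith
  have h2 := mul_le_mul_of_nonneg_left h1 (by positivity : 0 ≤ 2 * Real.sqrt d)
  have h3 := hr.1
  have h4 := hr'.2
  linarith

lemma le_measure_starRegion {d : ℕ} {n s₀ t : ℝ} (hn : 0 ≤ n) {ρ : Measure ℝ≥0}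
    [IsProbabilityMeasure ρ]
    (hρ : ∀ s, s₀ ≤ s → t ≤ s ^ d * ρ.real (radiusRange d s)) {k : ℕ} (hk : s₀ ≤ n / 2 ^ k)
    {c : Fin d → ℕ} (hc : ∀ i, c i < 2 ^ k) :
    ENNReal.ofReal ((k + 1) * t) ≤ ((torusVolume d n).prod ρ) (starRegion n k c) := by
  rw [starRegion, measure_biUnion_finset]
  · have hj : ∀ j ∈ Finset.range (k + 1), ENNReal.ofReal t ≤ ((torusVolume d n).prod ρ)
        (dyadicCube n j (ancestor k j c) ×ˢ radiusRange d (n / 2 ^ j)) := by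
      intro j hj
      have hjk : j ≤ k := Nat.lt_succ_iff.1 (Finset.mem_range.1 hj)
      have hanc : ∀ i, ancestor k j c i < 2 ^ j := by
        intro i
        rw [ancestor, Nat.div_lt_iff_lt_mul (by positivity), ← pow_add, Nat.add_sub_cancel' hjk]
        exact hc i
      have hs : s₀ ≤ n / 2 ^ j :=
        hk.trans (div_le_div_of_nonneg_left hn (by positivity) (pow_le_pow_right₀ (by norm_num) hjk))
      rw [Measure.prod_prod]
      calc ENNReal.ofReal t
          ≤ ENNReal.ofReal ((n / 2 ^ j) ^ d * ρ.real (radiusRange d (n / 2 ^ j))) :=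
            ENNReal.ofReal_le_ofReal (hρ _ hs)
        _ = ENNReal.ofReal ((n / 2 ^ j) ^ d) * ρ (radiusRange d (n / 2 ^ j)) := by
            rw [ENNReal.ofReal_mul (by positivity), ofReal_measureReal]
        _ ≤ _ := by gcongr; exact le_torusVolume_dyadicCube hn hanc
    calc ENNReal.ofReal ((k + 1) * t) = ∑ _j ∈ Finset.range (k + 1), ENNReal.ofReal t := by
          rw [Finset.sum_const, Finset.card_range, ENNReal.ofReal_mul (by positivity), nsmul_eq_mul]
          congr 1
          exact_mod_cast ENNReal.ofReal_natCast (k + 1)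
      _ ≤ _ := Finset.sum_le_sum hj
  · intro i _ j _ hij
    refine Set.disjoint_prod.2 (Or.inr ?_)
    rcases hij.lt_or_gt with h | h
    · exact disjoint_radiusRange hn h
    · exact (disjoint_radiusRange hn h).symm
  · exact fun j _ => (measurableSet_dyadicCube n j _).prod (measurableSet_radiusRange d _)

/-- Except on an event of probability at most `4⁻ᵏ`, the stars of large radius reach all the cubes of level `k`. -/
lemma measure_not_reached_le {Ω : Type*} [MeasurableSpace Ω] {μ : Measure Ω} {d : ℕ} {n s₀ : ℝ}
    (hn : 0 ≤ n) {ρ : Measure ℝ≥0} [IsProbabilityMeasure ρ]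
    {X : Ω → Finset (Torus d n × ℝ≥0)} (hX : IsMarkedPoisson X ρ μ)
    (hρ : ∀ s, s₀ ≤ s → (d + 3) * Real.log 2 ≤ s ^ d * ρ.real (radiusRange d s)) {k : ℕ}
    (hk : s₀ ≤ n / 2 ^ k) :
    μ {ω | ¬ ∀ c : Fin d → ℕ, (∀ i, c i < 2 ^ k) → ∃ z ∈ X ω, z ∈ starRegion n k c} ≤
      (1 / 4) ^ k := by
  have hlog : 0 ≤ Real.log 2 := Real.log_nonneg (by norm_num)
  have hsub : {ω | ¬ ∀ c : Fin d → ℕ, (∀ i, c i < 2 ^ k) → ∃ z ∈ X ω, z ∈ starRegion n k c} ⊆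
      ⋃ c : Fin d → Fin (2 ^ k), {ω | ∀ z ∈ X ω, z ∉ starRegion n k (fun i => (c i : ℕ))} := by
    intro ω hω
    simp only [Set.mem_ofPred_eq, not_forall, not_exists, not_and] at hω
    obtain ⟨c, hc, h⟩ := hω
    exact Set.mem_iUnion.2 ⟨fun i => ⟨c i, hc i⟩, h⟩
  have hvoid : ∀ c : Fin d → Fin (2 ^ k),
      μ {ω | ∀ z ∈ X ω, z ∉ starRegion n k (fun i => (c i : ℕ))} ≤
        ENNReal.ofReal ((1 / 2) ^ ((k + 1) * (d + 3))) := by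
    intro c
    have h := IsPoissonProcess.measure_void_le hX (measurableSet_starRegion n k _)
      (measure_ne_top _ _) (le_measure_starRegion hn hρ hk fun i => (c i).2)
    refine h.trans_eq (congrArg _ ?_)
    rw [one_div, inv_pow, Real.exp_neg, ← Real.exp_log (show (0 : ℝ) < 2 by norm_num),
      ← Real.exp_nat_mul, Real.log_exp]
    push_cast
    congr 2
    ring
  calc _ ≤ ∑ c : Fin d → Fin (2 ^ k), μ {ω | ∀ z ∈ X ω, z ∉ starRegion n k (fun i => (c i : ℕ))} :=
        (measure_mono hsub).trans (measure_iUnion_fintype_le _ _)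
    _ ≤ ∑ _c : Fin d → Fin (2 ^ k), ENNReal.ofReal ((1 / 2) ^ ((k + 1) * (d + 3))) :=
        Finset.sum_le_sum fun c _ => hvoid c
    _ = ENNReal.ofReal ((2 ^ k) ^ d * (1 / 2) ^ ((k + 1) * (d + 3))) := by
        rw [Finset.sum_const, nsmul_eq_mul, ENNReal.ofReal_mul (by positivity)]
        congr 1
        rw [Finset.card_univ, Fintype.card_fun, Fintype.card_fin, Fintype.card_fin,
          ← ENNReal.ofReal_natCast]
        push_cast
        rfl
    _ ≤ ENNReal.ofReal ((1 / 4) ^ k) := by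
        refine ENNReal.ofReal_le_ofReal ?_
        -- In the exponent, `k * d` pays for the number of cubes and `2 * k` leaves `4 ^ (-k)`; the
        -- rest is discarded.
        calc ((2 : ℝ) ^ k) ^ d * (1 / 2) ^ ((k + 1) * (d + 3))
            ≤ (2 ^ k) ^ d * (1 / 2) ^ (k * d + 2 * k) := by
              gcongr ?_ * ?_
              exact pow_le_pow_of_le_one (by norm_num) (by norm_num) (by nlinarith)
          _ = (1 / 4) ^ k := by
              rw [pow_add, ← pow_mul, ← mul_assoc, ← mul_pow, pow_mul _ 2]
              norm_num
    _ = (1 / 4) ^ k := by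
        rw [ENNReal.ofReal_pow (by norm_num), ENNReal.ofReal_div_of_pos (by norm_num)]
        simp

/-- With `a = 2√d`, the right-hand side tends to `β / a ^ d * (1 - 2 ^ (-d))`. As `a ^ d = 2 ^ d * d
^ (d / 2)`, the threshold on `β` makes this exceed `2 ^ d * (d + 1) * log 2`, which is at least `(d
+ 3) * log 2`. -/
lemma IsRadiusLaw.exists_le_radiusRange {d : ℕ} (hd : 2 ≤ d) {β : ℝ}
    (hβ : (d : ℝ) ^ ((d : ℝ) / 2) * 2 ^ (2 * d + 1) * ((d : ℝ) + 1) * Real.log 2 < β)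
    {ρ : Measure ℝ≥0} (hρ : IsRadiusLaw ρ (d : ℝ) β) :
    ∃ s₀ > 0, ∀ s, s₀ ≤ s → (d + 3) * Real.log 2 ≤ s ^ d * ρ.real (radiusRange d s) := by
  have := hρ.isProbabilityMeasure
  have hd0 : (0 : ℝ) < d := by exact_mod_cast (by omega : 0 < d)
  have hlog : 0 < Real.log 2 := Real.log_pos (by norm_num)
  have hrd : 0 < Real.sqrt d := Real.sqrt_pos.2 hd0
  set a : ℝ := 2 * Real.sqrt d with ha
  have ha0 : 0 < a := by positivity
  set t : ℝ → ℝ := fun h => h ^ (d : ℝ) * ρ.real {r : ℝ≥0 | h < r} with ht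
  have h1 : Tendsto (fun s : ℝ => t (a * s) / a ^ d - t (2 * (a * s)) / (2 * a) ^ d) atTop
      (𝓝 (β / a ^ d - β / (2 * a) ^ d)) :=
    ((hρ.tendsto_tail.comp (tendsto_id.const_mul_atTop ha0)).div_const _).sub
      ((hρ.tendsto_tail.comp ((tendsto_id.const_mul_atTop ha0).const_mul_atTop two_pos)).div_const _)
  have hpow : a ^ d = 2 ^ d * (d : ℝ) ^ ((d : ℝ) / 2) := by
    rw [ha, mul_pow, Real.sqrt_eq_rpow, ← Real.rpow_natCast, ← Real.rpow_natCast ((d : ℝ) ^ _),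
      ← Real.rpow_mul hd0.le]
    congr 2
    ring
  set q := (d : ℝ) ^ ((d : ℝ) / 2) with hq
  have hq0 : 0 < q := by positivity
  have h2 : (d + 3) * Real.log 2 < β / a ^ d - β / (2 * a) ^ d := by
    have h4 : (4 : ℝ) ≤ 2 ^ d := by
      calc (4 : ℝ) = 2 ^ 2 := by norm_num
        _ ≤ 2 ^ d := pow_le_pow_right₀ (by norm_num) hd
    have hβ0 : 0 < β := lt_trans (by positivity) hβ
    have e : β / a ^ d - β / (2 * a) ^ d = β / a ^ d * (1 - 1 / 2 ^ d) := by
      rw [mul_pow 2 a d]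
      have : a ^ d ≠ 0 := by positivity
      generalize a ^ d = b at *
      field_simp
    have h5 : (1 : ℝ) / 2 ≤ 1 - 1 / 2 ^ d := by
      have : (1 : ℝ) / 2 ^ d ≤ 1 / 4 := one_div_le_one_div_of_le (by norm_num) h4
      linarith
    have h6 : 2 * (d + 3) * Real.log 2 < β / a ^ d := by
      rw [lt_div_iff₀ (by positivity), hpow]
      refine lt_of_le_of_lt ?_ hβ
      have e2 : (2 : ℝ) ^ (2 * d + 1) = 2 * 2 ^ d * 2 ^ d := by ring
      rw [e2]
      have h7 : (d : ℝ) + 3 ≤ 2 ^ d * (d + 1) := by nlinarith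
      calc 2 * ((d : ℝ) + 3) * Real.log 2 * (2 ^ d * q)
          = (2 * Real.log 2 * 2 ^ d * q) * (d + 3) := by ring
        _ ≤ (2 * Real.log 2 * 2 ^ d * q) * (2 ^ d * (d + 1)) := by gcongr
        _ = _ := by ring
    rw [e]
    have h8 : β / a ^ d * (1 / 2) ≤ β / a ^ d * (1 - 1 / 2 ^ d) := by gcongr
    linarith
  obtain ⟨s₁, hs₁⟩ := eventually_atTop.1 (h1.eventually (lt_mem_nhds h2))
  refine ⟨max s₁ 1, by positivity, fun s hs => ?_⟩
  have hs0 : 0 < s := lt_of_lt_of_le one_pos ((le_max_right _ _).trans hs)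
  refine (hs₁ s ((le_max_left _ _).trans hs)).le.trans_eq ?_
  have hsplit : radiusRange d s = {r : ℝ≥0 | a * s < r} \ {r : ℝ≥0 | 2 * (a * s) < r} := by
    ext r
    simp only [radiusRange, Set.mem_ofPred_eq, Set.mem_sdiff, not_lt, ← ha]
  have hsub : {r : ℝ≥0 | 2 * (a * s) < r} ⊆ {r : ℝ≥0 | a * s < r} := fun r hr =>
    lt_trans (by linarith [mul_pos ha0 hs0]) (show 2 * (a * s) < (r : ℝ) from hr)
  have hdiff : ρ.real ({r : ℝ≥0 | a * s < r} \ {r : ℝ≥0 | 2 * (a * s) < r}) =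
      ρ.real {r : ℝ≥0 | a * s < r} - ρ.real {r : ℝ≥0 | 2 * (a * s) < r} :=
    measureReal_sdiff hsub (measurableSet_lt measurable_const measurable_subtype_coe)
  rw [hsplit, hdiff]
  have had : a ^ d ≠ 0 := by positivity
  simp only [ht, Real.rpow_natCast, mul_pow]
  generalize a ^ d = b at *
  field_simp

/-! ### Coupling the diameter with the total progeny -/

lemma exists_coupling_totalProgeny {Ω : Type*} [MeasurableSpace Ω] (μ : Measure Ω)
    [IsProbabilityMeasure μ] (D : Ω → ℕ∞) (d M : ℕ)
    (h : ∀ j < M, μ {ω | ¬ D ω ≤ 2 + 2 ^ (d + j)} ≤ (1 / 4) ^ (j + 1)) :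
    ∃ π : Measure (Ω × ℕ∞), IsCoupling π μ (totalProgenyLaw heavyOffspring) ∧
      π {p | 2 + 2 ^ d * p.2 < D p.1} ≤ (1 / 4) ^ M := by
  classical
  -- `D` is not assumed measurable, so the bad events are replaced by measurable hulls of the same
  -- measure.
  set F : ℕ → Set Ω := fun j => toMeasurable μ {ω | ¬ D ω ≤ 2 + 2 ^ (d + j)} with hF
  have hex : ∀ ω, ∃ j, j = M ∨ ω ∉ F j := fun ω => ⟨M, Or.inl rfl⟩
  -- The first good level, cut off at `M`. Since `j + 1 ≤ L` forces failure at level `j`, the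
  -- hypothesis carries the exponent `j + 1`.
  set L : Ω → ℕ := fun ω => Nat.find (hex ω) with hL
  have hLm : Measurable L := by
    refine measurable_find hex fun j => ?_
    have : {ω | j = M ∨ ω ∉ F j} = {_ω | j = M} ∪ (F j)ᶜ := rfl
    rw [this]
    exact (MeasurableSet.const _).union (measurableSet_toMeasurable _ _).compl
  have htail : ∀ j, μ {ω | j ≤ L ω} ≤ (1 / 4) ^ j := by
    rintro (_ | j)
    · simp
    have hnot : ∀ ω, j + 1 ≤ L ω → j ≠ M ∧ ω ∈ F j := by
      intro ω hω
      have := Nat.find_min (hex ω) (m := j) hω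
      push Not at this
      exact this
    have hle : ∀ ω, L ω ≤ M := fun ω => Nat.find_min' (hex ω) (Or.inl rfl)
    by_cases hj : j < M
    · calc μ {ω | j + 1 ≤ L ω} ≤ μ (F j) := measure_mono fun ω hω => (hnot ω hω).2
        _ ≤ _ := (measure_toMeasurable _).trans_le (h j hj)
    · have : {ω | j + 1 ≤ L ω} = ∅ := Set.eq_empty_of_forall_notMem fun ω hω => by
        have h1 : j + 1 ≤ L ω := hω
        have := hle ω
        omega
      rw [this, measure_empty]
      exact zero_le
  set P := Measure.infinitePi (fun _ : ℕ × ℕ => heavyOffspring.toMeasure)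
  have hJm : Measurable fun c : ℕ × ℕ → ℕ => Nat.log 2 (1 + c (0, 0)) :=
    (measurable_of_countable fun m : ℕ => Nat.log 2 (1 + m)).comp
      (measurable_pi_apply (X := fun _ : ℕ × ℕ => ℕ) (0, 0))
  obtain ⟨π, ⟨hπ1, hπ2⟩, hπ⟩ := exists_coupling_le μ P hLm hJm fun j =>
    (htail j).trans_eq (tail_ancestor_heavyOffspring j).symm
  have hT : Measurable (Prod.map id totalProgeny : Ω × (ℕ × ℕ → ℕ) → Ω × ℕ∞) :=
    measurable_id.prodMap measurable_totalProgeny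
  refine ⟨π.map (Prod.map id totalProgeny), ⟨?_, ?_⟩, ?_⟩
  · rw [Measure.map_map measurable_fst hT]
    exact hπ1
  · have h1 : totalProgenyLaw heavyOffspring = P.map totalProgeny := rfl
    rw [Measure.map_map measurable_snd hT, h1, ← hπ2,
      Measure.map_map measurable_totalProgeny measurable_snd]
    rfl
  -- A measurable set covering the failure event: either the cutoff is reached, or `T < 2 ^ L`,
  -- which is null under the coupling because `2 ^ L ≤ 2 ^ J ≤ T`.
  · set S : Set (Ω × ℕ∞) := {p | M ≤ L p.1} ∪ {p | p.2 < 2 ^ L p.1} with hS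
    have hSm : MeasurableSet S := by
      refine (measurableSet_le measurable_const (hLm.comp measurable_fst)).union ?_
      have hq : Measurable fun p : Ω × ℕ∞ => (L p.1, p.2) :=
        (hLm.comp measurable_fst).prodMk measurable_snd
      exact hq (MeasurableSet.of_discrete (s := {q : ℕ × ℕ∞ | q.2 < 2 ^ q.1}))
    have hsub : {p : Ω × ℕ∞ | 2 + 2 ^ d * p.2 < D p.1} ⊆ S := by
      intro p hp
      by_contra hpS
      simp only [hS, Set.mem_union, Set.mem_ofPred_eq, not_or, not_le, not_lt] at hpS
      have h1 : p.1 ∉ F (L p.1) := (Nat.find_spec (hex p.1)).resolve_left hpS.1.ne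
      have h2 : D p.1 ≤ 2 + 2 ^ (d + L p.1) := by
        by_contra hD
        exact h1 (subset_toMeasurable _ _ hD)
      have h3 : (2 : ℕ∞) + 2 ^ (d + L p.1) ≤ 2 + 2 ^ d * p.2 := by
        rw [pow_add]
        gcongr
        exact hpS.2
      exact absurd hp (not_lt.2 (h2.trans h3))
    refine (measure_mono hsub).trans ?_
    rw [Measure.map_apply hT hSm]
    have h1 : π ((Prod.map id totalProgeny) ⁻¹' {p : Ω × ℕ∞ | M ≤ L p.1}) ≤ (1 / 4) ^ M := by
      have h2 := htail M
      rw [← hπ1, Measure.map_apply measurable_fst (measurableSet_le measurable_const hLm)] at h2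
      exact h2
    have h2 : π ((Prod.map id totalProgeny) ⁻¹' {p : Ω × ℕ∞ | p.2 < 2 ^ L p.1}) = 0 := by
      refine measure_eq_zero_iff_ae_notMem.2 (hπ.mono fun p hp hlt => ?_)
      have h3 : totalProgeny p.2 < 2 ^ L p.1 := hlt
      have h4 : 2 ^ L p.1 ≤ 1 + p.2 (0, 0) :=
        (Nat.pow_le_pow_right two_pos hp).trans (Nat.pow_log_le_self 2 (by omega))
      have h5 : ((2 : ℕ∞) ^ L p.1) ≤ ((1 + p.2 (0, 0) : ℕ) : ℕ∞) := by exact_mod_cast h4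
      exact absurd h3 (not_lt.2 (h5.trans (one_add_le_totalProgeny p.2)))
    rw [hS, Set.preimage_union]
    exact (measure_union_le _ _).trans (by rw [h2, add_zero]; exact h1)

/-- The number of levels in which the dyadic cubes have side length at least `s`. -/
def levelCount (s n : ℝ) : ℕ := Nat.log 2 ⌊n / s⌋₊

lemma le_div_of_le_levelCount {s n : ℝ} (hs : 0 < s) (hn : s ≤ n) {k : ℕ}
    (hk : k ≤ levelCount s n) : s ≤ n / 2 ^ k := by
  have h1 : ⌊n / s⌋₊ ≠ 0 := (Nat.floor_pos.2 ((one_le_div hs).2 hn)).ne'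
  have h2 : 2 ^ k ≤ ⌊n / s⌋₊ := (Nat.pow_le_pow_right two_pos hk).trans (Nat.pow_log_le_self 2 h1)
  have h3 : (2 : ℝ) ^ k ≤ n / s := by
    calc (2 : ℝ) ^ k ≤ (⌊n / s⌋₊ : ℝ) := by exact_mod_cast h2
      _ ≤ n / s := Nat.floor_le (div_nonneg (hs.le.trans hn) hs.le)
  rw [le_div_iff₀ hs] at h3
  rw [le_div_iff₀ (by positivity)]
  linarith

/-- `2 ^ (levelCount s n + 1)` exceeds `n / s`. Weakening `1 / 4` to `1 / 2` gives up a power of `n`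
that is not needed, and the bound survives truncated subtraction when `levelCount s n < m`. -/
lemma quarter_pow_levelCount_le {s n : ℝ} (hs : 0 < s) (hn : 0 < n) (m : ℕ) :
    ((1 : ℝ) / 4) ^ (levelCount s n - m) ≤ 2 ^ (m + 1) * s * n⁻¹ := by
  have h1 : n / s < 2 ^ (levelCount s n + 1) := by
    calc n / s < (⌊n / s⌋₊ : ℝ) + 1 := Nat.lt_floor_add_one _
      _ ≤ 2 ^ (levelCount s n + 1) := by
        exact_mod_cast Nat.lt_pow_succ_log_self one_lt_two ⌊n / s⌋₊
  calc ((1 : ℝ) / 4) ^ (levelCount s n - m) ≤ (1 / 2) ^ (levelCount s n - m) := by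
        gcongr; norm_num
    _ ≤ 2 ^ (m + 1) * (2 ^ (levelCount s n + 1))⁻¹ := by
        rw [one_div, inv_pow, inv_eq_one_div, div_le_iff₀ (by positivity), ← div_eq_mul_inv,
          div_mul_eq_mul_div, one_le_div (by positivity), ← pow_add]
        exact pow_le_pow_right₀ (by norm_num) (by omega)
    _ ≤ 2 ^ (m + 1) * (n / s)⁻¹ := by gcongr
    _ = _ := by field_simp

end ScaleFreeGilbert

end

/-! ### Connectedness and the coupled diameter bound -/

theorem theorem5 (d : ℕ) (hd : 2 ≤ d) (β : ℝ)
    (hβ : (d : ℝ) ^ ((d : ℝ) / 2) * 2 ^ (2 * d + 1) * ((d : ℝ) + 1) * Real.log 2 < β)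
    (ρ : Measure ℝ≥0) (hρ : ScaleFreeGilbert.IsRadiusLaw ρ (d : ℝ) β)
    (Ω : ℝ → Type*) [∀ n, MeasurableSpace (Ω n)] (μ : ∀ n, Measure (Ω n))
    [∀ n, IsProbabilityMeasure (μ n)]
    (X : ∀ n : ℝ, Ω n → Finset (ScaleFreeGilbert.Torus d n × ℝ≥0))
    (hX : ∀ n : ℝ, 1 ≤ n → ScaleFreeGilbert.IsMarkedPoisson (X n) ρ (μ n)) :
    ScaleFreeGilbert.WithHighProbability μ
      (fun n => {ω | (ScaleFreeGilbert.gilbertGraph (X n ω)).Connected}) ∧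
    ∃ ν : PMF ℕ, ScaleFreeGilbert.IsSubcritical ν ∧
      ∃ π : ∀ n : ℝ, Measure (Ω n × ℕ∞),
        (∀ n : ℝ, 1 ≤ n →
          ScaleFreeGilbert.IsCoupling (π n) (μ n) (ScaleFreeGilbert.totalProgenyLaw ν)) ∧
        (fun n : ℝ => (π n).real
            {p | 2 + 2 ^ d * p.2 < (ScaleFreeGilbert.gilbertGraph (X n p.1)).ediam})
          =O[atTop] (fun n : ℝ => n⁻¹) := by
  have := hρ.isProbabilityMeasure
  obtain ⟨s, hs, hρs⟩ := hρ.exists_le_radiusRange hd hβ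
  have hbad : ∀ n : ℝ, 1 ≤ n → s ≤ n → ∀ k ≤ ScaleFreeGilbert.levelCount s n,
      μ n {ω | ¬ (Nonempty (X n ω) ∧ (ScaleFreeGilbert.gilbertGraph (X n ω)).ediam ≤ 2 + 2 ^ k)} ≤ (1 / 4) ^ k := by
    intro n hn hsn k hk
    have hn0 : 0 < n := one_pos.trans_le hn
    refine le_trans (measure_mono fun ω hω hc => hω (ScaleFreeGilbert.ediam_gilbertGraph_le hn0 hc))
      (ScaleFreeGilbert.measure_not_reached_le hn0.le (hX n hn) hρs (ScaleFreeGilbert.le_div_of_le_levelCount hs hsn hk))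
  constructor
  · have hlim : Tendsto (fun n : ℝ => ENNReal.ofReal (2 ^ (0 + 1) * s * n⁻¹)) atTop (𝓝 0) := by
      have := ENNReal.tendsto_ofReal (tendsto_inv_atTop_zero.const_mul (2 ^ (0 + 1) * s))
      simpa using this
    refine tendsto_of_tendsto_of_tendsto_of_le_of_le' tendsto_const_nhds hlim
      (Eventually.of_forall fun _ => zero_le) ?_
    filter_upwards [eventually_ge_atTop 1, eventually_ge_atTop s] with n hn hsn
    calc μ n {ω | (ScaleFreeGilbert.gilbertGraph (X n ω)).Connected}ᶜ
        ≤ μ n {ω | ¬ (Nonempty (X n ω) ∧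
            (ScaleFreeGilbert.gilbertGraph (X n ω)).ediam ≤ 2 + 2 ^ ScaleFreeGilbert.levelCount s n)} := by
          refine measure_mono fun ω hω hc => hω ?_
          have := hc.1
          refine SimpleGraph.connected_of_ediam_ne_top (ne_top_of_le_ne_top ?_ hc.2)
          exact_mod_cast ENat.natCast_ne_top (2 + 2 ^ ScaleFreeGilbert.levelCount s n)
      _ ≤ (1 / 4) ^ ScaleFreeGilbert.levelCount s n := hbad n hn hsn _ le_rfl
      _ = ENNReal.ofReal ((1 / 4) ^ (ScaleFreeGilbert.levelCount s n - 0)) := by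
          rw [ENNReal.ofReal_pow (by norm_num), ENNReal.ofReal_div_of_pos (by norm_num)]
          simp
      _ ≤ _ := ENNReal.ofReal_le_ofReal (ScaleFreeGilbert.quarter_pow_levelCount_le hs (one_pos.trans_le hn) 0)
  · refine ⟨ScaleFreeGilbert.heavyOffspring, ScaleFreeGilbert.isSubcritical_heavyOffspring, ?_⟩
    have hcoup : ∀ n : ℝ, ∃ π : Measure (Ω n × ℕ∞), 1 ≤ n →
        ScaleFreeGilbert.IsCoupling π (μ n) (ScaleFreeGilbert.totalProgenyLaw ScaleFreeGilbert.heavyOffspring) ∧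
        π {p | 2 + 2 ^ d * p.2 < (ScaleFreeGilbert.gilbertGraph (X n p.1)).ediam} ≤
          (1 / 4) ^ (ScaleFreeGilbert.levelCount s n - d) := by
      intro n
      by_cases hn : 1 ≤ n
      · have htail : ∀ j < ScaleFreeGilbert.levelCount s n - d,
            μ n {ω | ¬ (ScaleFreeGilbert.gilbertGraph (X n ω)).ediam ≤ 2 + 2 ^ (d + j)} ≤ (1 / 4) ^ (j + 1) := by
          intro j hj
          -- For `n < s` the level count is `0`, so there is no such `j`.
          have hsn : s ≤ n := by
            by_contra hlt
            have h0 : ⌊n / s⌋₊ = 0 :=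
              Nat.floor_eq_zero.2 ((div_lt_one hs).2 (not_le.1 hlt))
            simp [ScaleFreeGilbert.levelCount, h0] at hj
          calc μ n {ω | ¬ (ScaleFreeGilbert.gilbertGraph (X n ω)).ediam ≤ 2 + 2 ^ (d + j)}
              ≤ μ n {ω | ¬ (Nonempty (X n ω) ∧ (ScaleFreeGilbert.gilbertGraph (X n ω)).ediam ≤ 2 + 2 ^ (d + j))} :=
                measure_mono fun ω hω hc => hω hc.2
            _ ≤ (1 / 4) ^ (d + j) := hbad n hn hsn _ (by omega)
            -- The factor `2 ^ d` in the diameter bound shifts the level by `d ≥ 1`, which covers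
            -- the off-by-one in the tail of `L`.
            _ ≤ (1 / 4) ^ (j + 1) := pow_le_pow_of_le_one zero_le (by simp) (by omega)
        obtain ⟨π, hπ⟩ := ScaleFreeGilbert.exists_coupling_totalProgeny (μ n)
          (fun ω => (ScaleFreeGilbert.gilbertGraph (X n ω)).ediam) d (ScaleFreeGilbert.levelCount s n - d) htail
        exact ⟨π, fun _ => hπ⟩
      · exact ⟨0, fun h => absurd h hn⟩
    choose π hπ using hcoup
    refine ⟨π, fun n hn => (hπ n hn).1, ?_⟩
    refine Asymptotics.IsBigO.of_bound (2 ^ (d + 1) * s) ?_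
    filter_upwards [eventually_ge_atTop 1] with n hn
    have hn0 : 0 < n := one_pos.trans_le hn
    rw [Real.norm_of_nonneg measureReal_nonneg, Real.norm_of_nonneg (inv_nonneg.2 hn0.le)]
    refine le_trans ?_ (ScaleFreeGilbert.quarter_pow_levelCount_le hs hn0 d)
    refine (ENNReal.toReal_mono (by finiteness) (hπ n hn).2).trans_eq ?_
    simp
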